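/- All polynomials, sequences and arrays are over $\mathbb F_2$. The exponent of a polynomial $h$ with $h(0)\neq 0$ is the least positive integer $e$ with $h(x)\mid x^e-1$; a polynomial has uniform exponent $e$ if it is a product of one or more distinct irreducible polynomials, each of exponent $e$. For a polynomial $c(x)=1-\sum_{i=1}^n c_ix^i$ of degree $n$ with $c_n=1$, a sequence $(a_k)$ is generated by $c$ if $a_k=\sum_{i=1}^n c_i a_{k-i}$ for all $k$ beyond the initial state of $n$ bits. For non-constant $f_1,f_2$, let $f_1\vee f_2$ be the monic polynomial over $\mathbb F_2$ whose roots are simple and are exactly the products $\alpha\beta$ with $\alpha$ a root of $f_1$ and $\beta$ a root of $f_2$ in the splitting field of $f_1f_2$. Cyclic sequences that are shifts of each other are considered equal, and so are doubly-periodic (toroidal) arrays that are horizontal and vertical shifts of each other. A zero factor $\mathrm{ZF}(n,k)$ is a set of cyclic sequences of length and least period $k$ in which each nonzero $n$-tuple appears exactly once as a window. If $\gcd(r_1,r_2)=1$, folding a sequence $s_0,\dots,s_{r_1r_2-1}$ gives the $r_1\times r_2$ array whose entry $(i,j)$ is $s_k$, where $0\le k<r_1r_2$, $k\equiv i\pmod{r_1}$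 and $k\equiv j\pmod{r_2}$. An $(r_1,r_2;n_1,n_2)$-PRAC (pseudo-random array code) is a set $\mathcal C$ of $r_1\times r_2$ doubly-periodic arrays such that $r_1r_2\mid 2^{n_1n_2}-1$, each nonzero $n_1\times n_2$ matrix appears exactly once as a window in exactly one of the arrays, the zero $n_1\times n_2$ matrix does not appear as a window, and, whenever $A$ and $B$ are (shifts of) distinct codewords or $B$ is a nontrivial shift of a codeword $A$, the bitwise sum $A+B$ is again (a shift of) a codeword. **Theorem.** Let $r_1,r_2,n_1,n_2$ be positive integers with $\gcd(r_1,r_2)=1$, and for $i\in\{1,2\}$ let $f_i\in\mathbb F_2[x]$ have degree $n_i$ and uniform exponent $r_i$. Let $g=f_1\vee f_2$. Then: 1. $g$ has degree $n_1n_2$ and uniform exponent $r_1r_2$; 2. every nonzero sequence generated by $g$ has least period $r_1r_2$, and these sequences, considered as cyclic sequences, form a zero factor $\mathrm{ZF}(n_1n_2,r_1r_2)$; 3. folding the nonzero sequences generated by $g$ into $r_1\times r_2$ arrays yields an $(r_1,r_2;n_1,n_2)$-PRAC; 4. this code has exactly $(2^{n_1n_2}-1)/(r_1r_2)$ codewords.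 -/

import Mathlib

open Polynomial

/-! ### Cyclic patterns: cyclic sequences (`G = ZMod k`) and doubly-periodic arrays
(`G = ZMod r₁ × ZMod r₂`) -/

/-- The translate of a binary pattern on the additive group `G` by `t`. -/
def shift {G : Type*} [AddCommGroup G] (t : G) (A : G → ZMod 2) : G → ZMod 2 :=
  fun x => A (x + t)

/-- Two patterns are equivalent if one is a shift of the other. -/
def shiftSetoid (G : Type*) [AddCommGroup G] : Setoid (G → ZMod 2) where
  r A B := ∃ t, B = shift t A
  iseqv :=
    { refl := fun A => ⟨0, by funext x; simp [shift]⟩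
      symm := by
        rintro A B ⟨t, rfl⟩
        exact ⟨-t, by funext x; simp [shift]⟩
      trans := by
        rintro A B C ⟨t, rfl⟩ ⟨s, rfl⟩
        exact ⟨s + t, by funext x; simp [shift, add_assoc]⟩ }

/-- Patterns up to shifts: different shifts of a cyclic sequence, and different (horizontal and
vertical) shifts of a doubly-periodic array, are regarded as equal. -/
abbrev Cyclic (G : Type*) [AddCommGroup G] : Type _ := Quotient (shiftSetoid G)

/-- The class of a pattern up to shifts. -/
abbrev toCyclic {G : Type*} [AddCommGroup G] (A : G → ZMod 2) : Cyclic G :=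
  Quotient.mk (shiftSetoid G) A

/-- The number of positions of a cyclic pattern at which the window of shape `v` (the offsets of
its cells) has the content `M`. -/
noncomputable def occurrences {G ι : Type*} [AddCommGroup G] (v : ι → G) (M : ι → ZMod 2) :
    Cyclic G → ℕ :=
  Quotient.lift (fun A => Nat.card {x : G // ∀ i, A (x + v i) = M i}) (by
    rintro A B ⟨t, rfl⟩
    refine Nat.card_congr ((Equiv.subRight t).subtypeEquiv fun x => ?_)
    simp [shift, sub_add_eq_add_sub])

/-- Each nonzero content of a window of shape `v` appears exactly once as a window in one of the
members of `C` (and in no other member). -/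
def NonzeroWindowsOnce {G ι : Type*} [AddCommGroup G] (v : ι → G) (C : Set (Cyclic G)) : Prop :=
  ∀ M : ι → ZMod 2, M ≠ 0 →
    ∃ c ∈ C, occurrences v M c = 1 ∧ ∀ c' ∈ C, c' ≠ c → occurrences v M c' = 0

/-! ### Array codes -/

/-- The offsets of the cells of an `n₁ × n₂` window in an `r₁ × r₂` doubly-periodic array. -/
def arrayWindow (r₁ r₂ n₁ n₂ : ℕ) : Fin n₁ × Fin n₂ → ZMod r₁ × ZMod r₂ :=
  fun p => ((p.1 : ℕ), (p.2 : ℕ))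

/-- `(r₁,r₂;n₁,n₂)`-SDBAC: a shortened de Bruijn array code. The all-zero matrix is not a window
of any codeword, so that the number of codewords times `r₁ r₂` is `2 ^ (n₁ n₂) - 1`. -/
structure IsSDBAC (r₁ r₂ n₁ n₂ : ℕ) (C : Set (Cyclic (ZMod r₁ × ZMod r₂))) : Prop where
  dvd : r₁ * r₂ ∣ 2 ^ (n₁ * n₂) - 1
  windows : NonzeroWindowsOnce (arrayWindow r₁ r₂ n₁ n₂) C
  zero_window : ∀ c ∈ C, occurrences (arrayWindow r₁ r₂ n₁ n₂) 0 c = 0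

/-- `(r₁,r₂;n₁,n₂)`-PRAC: a pseudo-random array code, i.e. an SDBAC with the shift-and-add
property. The sum of two arrays is taken bit by bit. -/
structure IsPRAC (r₁ r₂ n₁ n₂ : ℕ) (C : Set (Cyclic (ZMod r₁ × ZMod r₂))) : Prop
    extends IsSDBAC r₁ r₂ n₁ n₂ C where
  shift_and_add : ∀ A B : ZMod r₁ × ZMod r₂ → ZMod 2,
    toCyclic A ∈ C → toCyclic B ∈ C →
    (toCyclic A ≠ toCyclic B ∨ ∃ t, t ≠ 0 ∧ B = shift t A) → toCyclic (A + B) ∈ C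

/-! ### Shift-register sequences -/

/-- The sequence `a` is generated by the characteristic polynomial
`c(x) = 1 - ∑_{i=1}^n cᵢ xⁱ` of degree `n` over `𝔽₂`, i.e. `aₖ = ∑_{i=1}^n cᵢ aₖ₋ᵢ`;
the sequence is indexed so that its initial state is `(a₀, …, aₙ₋₁)`. -/
def Generates (c : (ZMod 2)[X]) (a : ℕ → ZMod 2) : Prop :=
  ∀ k, a (k + c.natDegree) =
    ∑ i ∈ Finset.Icc 1 c.natDegree, -c.coeff i * a (k + c.natDegree - i)

/-- The least period of the sequence `a` is `π`. -/
def HasLeastPeriod (a : ℕ → ZMod 2) (π : ℕ) : Prop :=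
  IsLeast {p : ℕ | 0 < p ∧ ∀ i, a (i + p) = a i} π

/-- The cyclic sequences of length `k` given by the nonzero sequences that `c` generates
(one period of length `k` is taken of each). -/
def generatedCycles (c : (ZMod 2)[X]) (k : ℕ) : Set (Cyclic (ZMod k)) :=
  {s | ∃ a : ℕ → ZMod 2, Generates c a ∧ a ≠ 0 ∧ s = toCyclic (fun x : ZMod k => a x.val)}

/-- A zero factor ZF`(n,k)`: a set of cyclic sequences of least period `k` (and length `k`) that
contains each nonzero `n`-tuple exactly once as a window in one of the cycles. -/
structure IsZeroFactor (n k : ℕ) (Z : Set (Cyclic (ZMod k))) : Prop where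
  leastPeriod : ∀ w : ZMod k → ZMod 2, toCyclic w ∈ Z → HasLeastPeriod (fun m => w m) k
  windows : NonzeroWindowsOnce (fun i : Fin n => ((i : ℕ) : ZMod k)) Z

/-- The shift register with characteristic polynomial `c` produces a zero factor ZF`(n,k)`: all
nonzero sequences that it generates have least period `k`, and they form a zero factor. -/
structure ProducesZeroFactor (c : (ZMod 2)[X]) (n k : ℕ) : Prop where
  leastPeriod : ∀ a : ℕ → ZMod 2, Generates c a → a ≠ 0 → HasLeastPeriod a k
  zeroFactor : IsZeroFactor n k (generatedCycles c k)

/-! ### Polynomials over `𝔽₂` -/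

/-- The exponent of `h` is `e`: the least positive integer such that `h` divides `x ^ e - 1`. -/
def HasExponent (h : (ZMod 2)[X]) (e : ℕ) : Prop :=
  IsLeast {m : ℕ | 0 < m ∧ h ∣ X ^ m - 1} e

/-- `f` has uniform exponent `e`: it is a product of distinct irreducible polynomials of
exponent `e` (a single factor is allowed). -/
def HasUniformExponent (f : (ZMod 2)[X]) (e : ℕ) : Prop :=
  ∃ s : Finset (ZMod 2)[X], (∀ p ∈ s, Irreducible p ∧ HasExponent p e) ∧ f = ∏ p ∈ s, p

open Classical in
/-- The set of all products `αβ` of a root `α` of `f₁` and a root `β` of `f₂` in the splitting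
field of `f₁ f₂`. -/
noncomputable def rootProducts (f₁ f₂ : (ZMod 2)[X]) : Finset (f₁ * f₂).SplittingField :=
  Finset.image₂ (· * ·) (f₁.aroots (f₁ * f₂).SplittingField).toFinset
    (f₂.aroots (f₁ * f₂).SplittingField).toFinset

/-- The monic polynomial whose roots are the products of roots has coefficients in `𝔽₂`. -/
theorem exists_vee (f₁ f₂ : (ZMod 2)[X]) :
    ∃ g : (ZMod 2)[X], g.map (algebraMap (ZMod 2) (f₁ * f₂).SplittingField) =
      ∏ γ ∈ rootProducts f₁ f₂, (X - C γ) := by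
  classical
  set K := (f₁ * f₂).SplittingField
  have hchar : CharP K 2 := charP_of_injective_algebraMap (algebraMap (ZMod 2) K).injective 2
  have hsq : ∀ f : (ZMod 2)[X], ∀ x : K, aeval x f = 0 → aeval (x ^ 2) f = 0 := by
    intro f x hx
    have h := ZMod.expand_card f
    have h2 : aeval x (expand (ZMod 2) 2 f) = aeval x (f ^ 2) := by rw [h]
    rw [expand_aeval, map_pow, hx] at h2
    simpa using h2
  have hS : (rootProducts f₁ f₂).image (frobenius K 2) = rootProducts f₁ f₂ := by
    refine Finset.eq_of_subset_of_card_le ?_ ?_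
    · intro y hy
      obtain ⟨x, hx, rfl⟩ := Finset.mem_image.1 hy
      obtain ⟨α, hα, β, hβ, rfl⟩ := Finset.mem_image₂.1 hx
      simp only [Multiset.mem_toFinset, mem_aroots] at hα hβ
      refine Finset.mem_image₂.2 ⟨α ^ 2, ?_, β ^ 2, ?_, ?_⟩
      · simpa only [Multiset.mem_toFinset, mem_aroots] using ⟨hα.1, hsq _ _ hα.2⟩
      · simpa only [Multiset.mem_toFinset, mem_aroots] using ⟨hβ.1, hsq _ _ hβ.2⟩
      · simp [frobenius_def, mul_pow]
    · rw [Finset.card_image_of_injective _ (frobenius_inj K 2)]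
  set P : K[X] := ∏ γ ∈ rootProducts f₁ f₂, (X - C γ) with hP
  have hmap : P.map (frobenius K 2) = P := by
    conv_rhs => rw [hP, ← hS]
    rw [Finset.prod_image fun x _ y _ h => frobenius_inj K 2 h, hP, Polynomial.map_prod]
    refine Finset.prod_congr rfl fun x _ => ?_
    rw [Polynomial.map_sub, map_X, map_C]
  have hlift : P ∈ lifts (algebraMap (ZMod 2) K) := by
    rw [lifts_iff_coeff_lifts]
    intro n
    have h := congrArg (fun Q => Q.coeff n) hmap
    simp only [coeff_map, frobenius_def] at h
    have h' : P.coeff n * (P.coeff n - 1) = 0 := by linear_combination h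
    rcases mul_eq_zero.1 h' with h0 | h1
    · exact ⟨0, by rw [map_zero, h0]⟩
    · exact ⟨1, by rw [map_one, sub_eq_zero.1 h1]⟩
  exact (mem_lifts _).1 hlift

/-- `f₁ ∨ f₂`: the monic polynomial over `𝔽₂` whose (simple) roots are the products `αβ`, where
`α` is a root of `f₁` and `β` is a root of `f₂`. -/
noncomputable def vee (f₁ f₂ : (ZMod 2)[X]) : (ZMod 2)[X] :=
  Classical.choose (exists_vee f₁ f₂)

theorem vee_map (f₁ f₂ : (ZMod 2)[X]) :
    (vee f₁ f₂).map (algebraMap (ZMod 2) (f₁ * f₂).SplittingField) =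
      ∏ γ ∈ rootProducts f₁ f₂, (X - C γ) :=
  Classical.choose_spec (exists_vee f₁ f₂)

/-! ### Folding -/

/-- Folding of a word of length `r₁ r₂` into an `r₁ × r₂` array: the entry in position `(i, j)` is
the entry of the word in the position `k` with `k ≡ i (mod r₁)` and `k ≡ j (mod r₂)`. -/
def fold {r₁ r₂ : ℕ} (h : Nat.Coprime r₁ r₂) (w : ZMod (r₁ * r₂) → ZMod 2) :
    ZMod r₁ × ZMod r₂ → ZMod 2 :=
  fun p => w ((ZMod.chineseRemainder h).symm p)

/-- Folding of a cyclic sequence into a doubly-periodic array. -/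
def foldCyclic {r₁ r₂ : ℕ} (h : Nat.Coprime r₁ r₂) :
    Cyclic (ZMod (r₁ * r₂)) → Cyclic (ZMod r₁ × ZMod r₂) :=
  Quotient.lift (fun w => toCyclic (fold h w)) (by
    rintro w _ ⟨t, rfl⟩
    refine Quotient.sound ⟨ZMod.chineseRemainder h t, ?_⟩
    funext p
    simp [fold, shift, map_add])

/-- The array code obtained by folding the nonzero sequences generated by `g`, each of them taken
as a cyclic sequence of length `r₁ r₂`. -/
def foldedCode {r₁ r₂ : ℕ} (h : Nat.Coprime r₁ r₂) (g : (ZMod 2)[X]) :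
    Set (Cyclic (ZMod r₁ × ZMod r₂)) :=
  foldCyclic h '' generatedCycles g (r₁ * r₂)

/-!
Every root of `fᵢ` has multiplicative order `rᵢ`, and `fᵢ` is separable. As `r₁` and `r₂` are
coprime, a product `αβ` of roots of `f₁` and `f₂` has order `r₁ r₂` and determines `α` and `β`
(`eq_and_eq_of_mul_eq_mul`), which gives the degree and the uniform exponent of `g = f₁ ∨ f₂`.

Since the roots of `g` are simple and nonzero, Vandermonde's determinant shows that each sequence
generated by `g` has the form `aₖ = ∑ c(α, β) (αβ)⁻ᵏ` (`Generates.exists_eq_sum_vee`). By the same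
determinant a period `p` of a nonzero such sequence satisfies `(αβ)ᵖ = 1` for some `α`, `β`, so that
`r₁ r₂` is the least period (`dvd_of_periodic_of_eq_sum`). In the folded array the entry `(i, j)`
equals `∑ c(α, β) α⁻ⁱ β⁻ʲ`, because `αᵏ` and `βᵏ` depend only on `k` modulo `r₁` and modulo `r₂`.
Vandermonde's determinant, applied in each of the two directions, shows that all `c(α, β)` vanish if
the entries with `i < n₁`, `j < n₂` do (`Generates.eq_zero_of_window_vee`). As there are `2 ^ (n₁ n₂)`
sequences and as many `n₁ × n₂` matrices, each matrix is the window at the origin of exactly one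
folded sequence.

What remains holds for any shift-invariant linear space of patterns on a group `G` in which the
shifts of a nonzero pattern are pairwise distinct and in which the window at the origin determines
the pattern and is arbitrary (`IsWindowSpace`): the windows of a pattern are the windows at the origin
of its shifts, so each nonzero content occurs exactly once, and counting the nonzero patterns by free
orbits gives the number of classes (`IsWindowSpace.ncard_mul_card`). This is applied to
`G = ZMod (r₁ r₂)` and to `G = ZMod r₁ × ZMod r₂`.
-/

/-! ### Codes from shift-invariant spaces of patterns -/

section Patterns

variable {G ι : Type*} [AddCommGroup G]

theorem shift_add (s t : G) (A : G → ZMod 2) : shift (s + t) A = shift t (shift s A) := by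
  funext x
  simp [shift, add_assoc, add_comm t s]

theorem shift_zero (A : G → ZMod 2) : shift 0 A = A := by
  funext x
  simp [shift]

theorem toCyclic_eq_iff {A B : G → ZMod 2} : toCyclic A = toCyclic B ↔ ∃ t, B = shift t A :=
  Quotient.eq (r := shiftSetoid G)

/-- The classes up to shifts of the nonzero members of a space of patterns. -/
def nonzeroClasses (V : Submodule (ZMod 2) (G → ZMod 2)) : Set (Cyclic G) :=
  {c | ∃ A ∈ V, A ≠ 0 ∧ c = toCyclic A}

/-- A space of patterns that is invariant under shifts, in which no nonzero pattern is fixed by a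
nontrivial shift, and in which a pattern is determined by the content of its window of shape `v`
at the origin, this content being arbitrary. -/
structure IsWindowSpace (v : ι → G) (V : Submodule (ZMod 2) (G → ZMod 2)) : Prop where
  shift_mem : ∀ A ∈ V, ∀ t, shift t A ∈ V
  eq_zero_of_shift_eq : ∀ A ∈ V, A ≠ 0 → ∀ t, shift t A = A → t = 0
  existsUnique_window : ∀ M : ι → ZMod 2, ∃! A, A ∈ V ∧ ∀ i, A (v i) = M i

namespace IsWindowSpace

variable {v : ι → G} {V : Submodule (ZMod 2) (G → ZMod 2)}

theorem toCyclic_mem_iff (h : IsWindowSpace v V) {A : G → ZMod 2} :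
    toCyclic A ∈ nonzeroClasses V ↔ A ∈ V ∧ A ≠ 0 := by
  constructor
  · rintro ⟨B, hB, hB0, hAB⟩
    obtain ⟨t, rfl⟩ := toCyclic_eq_iff.1 hAB.symm
    refine ⟨h.shift_mem B hB t, fun h0 => hB0 ?_⟩
    funext x
    simpa [shift] using congrFun h0 (x - t)
  · rintro ⟨hA, hA0⟩
    exact ⟨A, hA, hA0, rfl⟩

theorem eq_zero_of_window (h : IsWindowSpace v V) {A : G → ZMod 2} (hA : A ∈ V)
    (hw : ∀ i, A (v i) = 0) : A = 0 :=
  (h.existsUnique_window 0).unique ⟨hA, hw⟩ ⟨V.zero_mem, fun _ => rfl⟩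

theorem window_shift_iff (A : G → ZMod 2) (M : ι → ZMod 2) (x : G) :
    (∀ i, A (x + v i) = M i) ↔ ∀ i, shift x A (v i) = M i := by
  simp [shift, add_comm]

theorem shift_injective (h : IsWindowSpace v V) {A : G → ZMod 2} (hA : A ∈ V) (hA0 : A ≠ 0)
    {s t : G} (hst : shift s A = shift t A) : s = t := by
  refine sub_eq_zero.1 (h.eq_zero_of_shift_eq A hA hA0 _ ?_)
  rw [sub_eq_add_neg, shift_add, hst, ← shift_add, add_neg_cancel, shift_zero]

theorem nonzeroWindowsOnce (h : IsWindowSpace v V) : NonzeroWindowsOnce v (nonzeroClasses V) := by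
  intro M hM
  obtain ⟨A, ⟨hA, hAM⟩, huniq⟩ := h.existsUnique_window M
  have hA0 : A ≠ 0 := by
    rintro rfl
    exact hM (funext fun i => (hAM i).symm)
  refine ⟨toCyclic A, ⟨A, hA, hA0, rfl⟩, ?_, ?_⟩
  · change Nat.card {x : G // ∀ i, A (x + v i) = M i} = 1
    have hx : ∀ x : G, (∀ i, A (x + v i) = M i) ↔ x = 0 := by
      intro x
      rw [window_shift_iff]
      constructor
      · intro hx
        exact h.eq_zero_of_shift_eq A hA hA0 x (huniq _ ⟨h.shift_mem A hA x, hx⟩)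
      · rintro rfl
        simpa [shift_zero] using hAM
    simp [hx]
  · rintro _ ⟨B, hB, hB0, rfl⟩ hne
    change Nat.card {x : G // ∀ i, B (x + v i) = M i} = 0
    have : IsEmpty {x : G // ∀ i, B (x + v i) = M i} := by
      refine ⟨fun x => hne (toCyclic_eq_iff.2 ⟨x.1, ?_⟩)⟩
      exact (huniq _ ⟨h.shift_mem B hB x.1, (window_shift_iff B M x.1).1 x.2⟩).symm
    exact Nat.card_of_isEmpty

theorem occurrences_zero (h : IsWindowSpace v V) {c : Cyclic G} (hc : c ∈ nonzeroClasses V) :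
    occurrences v 0 c = 0 := by
  obtain ⟨B, hB, hB0, rfl⟩ := hc
  change Nat.card {x : G // ∀ i, B (x + v i) = 0} = 0
  have : IsEmpty {x : G // ∀ i, B (x + v i) = 0} := by
    refine ⟨fun x => ?_⟩
    have hx := h.eq_zero_of_window (h.shift_mem B hB x.1) ((window_shift_iff B 0 x.1).1 x.2)
    refine ((h.toCyclic_mem_iff (A := shift x.1 B)).1 ?_).2 hx
    exact ⟨B, hB, hB0, (toCyclic_eq_iff.2 ⟨x.1, rfl⟩).symm⟩
  exact Nat.card_of_isEmpty

theorem toCyclic_add_mem (h : IsWindowSpace v V) {A B : G → ZMod 2}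
    (hA : toCyclic A ∈ nonzeroClasses V) (hB : toCyclic B ∈ nonzeroClasses V) (hAB : A ≠ B) :
    toCyclic (A + B) ∈ nonzeroClasses V := by
  rw [h.toCyclic_mem_iff] at *
  refine ⟨V.add_mem hA.1 hB.1, fun h0 => hAB ?_⟩
  rw [← CharTwo.sub_eq_add] at h0
  exact sub_eq_zero.1 h0

/-- Every orbit of nonzero patterns under shifts is free, and the windows at the origin
parametrize the nonzero patterns. -/
theorem ncard_mul_card [Finite ι] (h : IsWindowSpace v V) :
    (nonzeroClasses V).ncard * Nat.card G = 2 ^ Nat.card ι - 1 := by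
  classical
  have := Fintype.ofFinite ι
  have hout : ∀ c : nonzeroClasses V, c.1.out ∈ V ∧ c.1.out ≠ 0 := by
    intro c
    rw [← h.toCyclic_mem_iff]
    convert c.2
    exact Quotient.out_eq c.1
  -- a class and a position are sent to the window of the chosen representative at this position
  let e : nonzeroClasses V × G → {M : ι → ZMod 2 // M ≠ 0} := fun p =>
    ⟨fun i => shift p.2 p.1.1.out (v i), fun h0 => by
      have hm := h.shift_mem _ (hout p.1).1 p.2
      have hz := h.eq_zero_of_window hm (congrFun h0)
      refine (hout p.1).2 ?_
      rw [← shift_zero p.1.1.out, ← add_neg_cancel p.2, shift_add, hz]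
      rfl⟩
  have he : Function.Bijective e := by
    constructor
    · rintro ⟨c, s⟩ ⟨d, t⟩ hcd
      have hw : shift s c.1.out = shift t d.1.out :=
        (h.existsUnique_window (e (d, t)).1).unique
          ⟨h.shift_mem _ (hout c).1 s, congrFun (congrArg Subtype.val hcd)⟩
          ⟨h.shift_mem _ (hout d).1 t, fun _ => rfl⟩
      have h1 : toCyclic c.1.out = toCyclic d.1.out :=
        (toCyclic_eq_iff.2 ⟨s, rfl⟩).trans (hw ▸ (toCyclic_eq_iff.2 ⟨t, rfl⟩).symm)
      have hc : c = d := by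
        apply Subtype.ext
        rw [← Quotient.out_eq c.1, ← Quotient.out_eq d.1]
        exact h1
      subst hc
      rw [h.shift_injective (hout c).1 (hout c).2 hw]
    · rintro ⟨M, hM⟩
      obtain ⟨A, ⟨hA, hAM⟩, -⟩ := h.existsUnique_window M
      have hA0 : A ≠ 0 := by
        rintro rfl
        exact hM (funext fun i => (hAM i).symm)
      let c : nonzeroClasses V := ⟨toCyclic A, A, hA, hA0, rfl⟩
      obtain ⟨t, ht⟩ := toCyclic_eq_iff.1 (Quotient.out_eq c.1)
      refine ⟨(c, t), Subtype.ext (funext fun i => ?_)⟩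
      change shift t c.1.out (v i) = M i
      rw [← ht, hAM]
  have hcard := Nat.card_congr (Equiv.ofBijective e he)
  rw [Nat.card_prod, Nat.card_coe_set_eq] at hcard
  rw [hcard, Nat.card_eq_fintype_card, Fintype.card_subtype_compl, Fintype.card_subtype_eq]
  simp

/-- Two window shapes with the same number of cells: since all sets involved are finite, it
suffices that the content of the second window determines the pattern. -/
theorem of_card_eq {κ : Type*} [Finite ι] [Finite κ] (h : IsWindowSpace v V) (u : κ → G)
    (hcard : Nat.card κ = Nat.card ι) (hu : ∀ A ∈ V, (∀ j, A (u j) = 0) → A = 0) :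
    IsWindowSpace u V where
  shift_mem := h.shift_mem
  eq_zero_of_shift_eq := h.eq_zero_of_shift_eq
  existsUnique_window := by
    choose S hS _ using h.existsUnique_window
    -- `φ` sends the content of the window `v` to that of the window `u` of the same pattern
    let φ : (ι → ZMod 2) → (κ → ZMod 2) := fun M j => S M (u j)
    have huinj : ∀ A ∈ V, ∀ B ∈ V, (∀ j, A (u j) = B (u j)) → A = B := fun A hA B hB hAB =>
      sub_eq_zero.1 (hu _ (V.sub_mem hA hB) fun j => by simp [hAB j])
    have hinj : Function.Injective φ := by
      intro M N hMN
      have hST := huinj _ (hS M).1 _ (hS N).1 (congrFun hMN)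
      funext i
      rw [← (hS M).2 i, ← (hS N).2 i, hST]
    have hbij : Function.Bijective φ :=
      hinj.bijective_of_nat_card_le (by simp [Nat.card_fun, hcard])
    intro M
    obtain ⟨N, hN⟩ := hbij.2 M
    refine ⟨S N, ⟨(hS N).1, congrFun hN⟩, fun B hB => huinj _ hB.1 _ (hS N).1 fun j => ?_⟩
    rw [hB.2 j, ← hN]

/-- Transport of a window space along an isomorphism of the groups of positions. -/
theorem map_equiv {H : Type*} [AddCommGroup H] (h : IsWindowSpace v V) (e : G ≃+ H) :
    IsWindowSpace (fun i => e (v i)) (V.map (LinearMap.funLeft (ZMod 2) (ZMod 2) e.symm)) where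
  shift_mem := by
    rintro _ ⟨A, hA, rfl⟩ t
    refine ⟨shift (e.symm t) A, h.shift_mem A hA _, ?_⟩
    funext x
    simp [shift, LinearMap.funLeft]
  eq_zero_of_shift_eq := by
    rintro _ ⟨A, hA, rfl⟩ hA0 t ht
    rw [← e.symm.map_eq_zero_iff]
    refine h.eq_zero_of_shift_eq A hA ?_ _ ?_
    · rintro rfl
      exact hA0 (map_zero _)
    · funext x
      simpa [shift, LinearMap.funLeft] using congrFun ht (e x)
  existsUnique_window := by
    intro M
    obtain ⟨A, ⟨hA, hAM⟩, huniq⟩ := h.existsUnique_window M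
    refine ⟨_, ⟨⟨A, hA, rfl⟩, fun i => by simpa [LinearMap.funLeft] using hAM i⟩, ?_⟩
    rintro _ ⟨⟨B, hB, rfl⟩, hBM⟩
    rw [huniq B ⟨hB, fun i => by simpa [LinearMap.funLeft] using hBM i⟩]

end IsWindowSpace

end Patterns

/-! ### Power-sum representation of shift-register sequences -/

section Sequences

variable {K : Type*} [Field K]

/-- Injectivity of the Vandermonde matrix, for nodes indexed by an arbitrary finite type. -/
theorem eq_zero_of_sum_mul_pow_eq_zero {ι : Type*} [Fintype ι] {ρ c : ι → K}
    (hρ : Function.Injective ρ) (h : ∀ k < Fintype.card ι, ∑ i, c i * ρ i ^ k = 0) : c = 0 := by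
  let e := Fintype.equivFin ι
  have h0 : c ∘ e.symm = 0 := by
    refine Matrix.eq_zero_of_forall_pow_sum_mul_pow_eq_zero
      (f := ρ ∘ e.symm) (hρ.comp e.symm.injective) fun k => ?_
    rw [← h k k.2]
    exact Equiv.sum_comp e.symm fun i => c i * ρ i ^ (k : ℕ)
  funext i
  simpa using congrFun h0 (e i)

theorem exists_sum_mul_pow_eq {ι : Type*} [Fintype ι] {ρ : ι → K}
    (hρ : Function.Injective ρ) (b : ℕ → K) :
    ∃ c : ι → K, ∀ k < Fintype.card ι, ∑ i, c i * ρ i ^ k = b k := by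
  let φ : (ι → K) →ₗ[K] (Fin (Fintype.card ι) → K) :=
    { toFun := fun c k => ∑ i, c i * ρ i ^ (k : ℕ)
      map_add' := fun c d => by
        funext k
        simp [add_mul, Finset.sum_add_distrib]
      map_smul' := fun a c => by
        funext k
        simp [Finset.mul_sum, mul_assoc] }
  have hinj : Function.Injective φ := by
    rw [← LinearMap.ker_eq_bot, LinearMap.ker_eq_bot']
    exact fun c hc => eq_zero_of_sum_mul_pow_eq_zero hρ fun k hk => congrFun hc ⟨k, hk⟩
  have hsurj : Function.Surjective φ :=
    (LinearMap.injective_iff_surjective_of_finrank_eq_finrank (by simp)).1 hinj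
  obtain ⟨c, hc⟩ := hsurj fun k => b k
  exact ⟨c, fun k hk => congrFun hc ⟨k, hk⟩⟩

/-- Two-dimensional Vandermonde injectivity: the nodes form a product set. -/
theorem eq_zero_of_sum_mul_pow_mul_pow_eq_zero {ι κ : Type*} [Fintype ι] [Fintype κ]
    {ρ : ι → K} {σ : κ → K} {c : ι × κ → K}
    (hρ : Function.Injective ρ) (hσ : Function.Injective σ)
    (h : ∀ k < Fintype.card ι, ∀ l < Fintype.card κ,
      ∑ p : ι × κ, c p * (ρ p.1 ^ k * σ p.2 ^ l) = 0) : c = 0 := by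
  have h1 : ∀ l < Fintype.card κ, (fun i => ∑ j, c (i, j) * σ j ^ l) = 0 := by
    intro l hl
    refine eq_zero_of_sum_mul_pow_eq_zero hρ fun k hk => ?_
    rw [← h k hk l hl, Fintype.sum_prod_type]
    refine Finset.sum_congr rfl fun i _ => ?_
    rw [Finset.sum_mul]
    exact Finset.sum_congr rfl fun j _ => by ring
  funext ⟨i, j⟩
  exact congrFun (eq_zero_of_sum_mul_pow_eq_zero (c := fun j => c (i, j)) hσ
    fun l hl => congrFun (h1 l hl) i) j

/-- The linear recurrence `u (k + n) = -∑ gᵢ u (k + n - i)` of order `n = deg g` over `R`. Its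
`charPoly` in the sense of Mathlib is the reciprocal of `g`: the geometric solutions have the
inverses of the roots of `g` as their ratios. -/
noncomputable def shiftRegister (g : (ZMod 2)[X]) (R : Type*) [CommRing R] [Algebra (ZMod 2) R] :
    LinearRecurrence R where
  order := g.natDegree
  coeffs i := -algebraMap (ZMod 2) R (g.coeff (g.natDegree - i))

theorem shiftRegister_isSolution_iff (g : (ZMod 2)[X]) {R : Type*} [CommRing R]
    [Algebra (ZMod 2) R] (u : ℕ → R) :
    (shiftRegister g R).IsSolution u ↔ ∀ k, u (k + g.natDegree) =
      ∑ i ∈ Finset.Icc 1 g.natDegree,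
        -algebraMap (ZMod 2) R (g.coeff i) * u (k + g.natDegree - i) := by
  refine forall_congr' fun k => ?_
  have : ∑ i ∈ Finset.Icc 1 g.natDegree,
      -algebraMap (ZMod 2) R (g.coeff i) * u (k + g.natDegree - i) =
      ∑ i : Fin g.natDegree,
        -algebraMap (ZMod 2) R (g.coeff (g.natDegree - i)) * u (k + i) := by
    rw [Fin.sum_univ_eq_sum_range
      (fun i => -algebraMap (ZMod 2) R (g.coeff (g.natDegree - i)) * u (k + i))]
    refine Finset.sum_nbij' (fun i => g.natDegree - i) (fun i => g.natDegree - i) ?_ ?_ ?_ ?_ ?_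
    · intro i hi
      simp only [Finset.mem_Icc, Finset.mem_range] at *
      omega
    · intro i hi
      simp only [Finset.mem_Icc, Finset.mem_range] at *
      omega
    · intro i hi
      simp only [Finset.mem_Icc] at hi
      omega
    · intro i hi
      simp only [Finset.mem_range] at hi
      omega
    · intro i hi
      simp only [Finset.mem_Icc] at hi
      rw [Nat.sub_sub_self hi.2, Nat.add_sub_assoc hi.2]
  rw [this]
  rfl

theorem generates_iff (g : (ZMod 2)[X]) (a : ℕ → ZMod 2) :
    Generates g a ↔ (shiftRegister g (ZMod 2)).IsSolution a := by
  rw [shiftRegister_isSolution_iff]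
  rfl

variable [Algebra (ZMod 2) K]

theorem Generates.isSolution_algebraMap {g : (ZMod 2)[X]} {a : ℕ → ZMod 2} (ha : Generates g a) :
    (shiftRegister g K).IsSolution fun k => algebraMap (ZMod 2) K (a k) := by
  rw [shiftRegister_isSolution_iff]
  intro k
  simp only [ha k, map_sum, map_mul, map_neg]

theorem isSolution_inv_pow {g : (ZMod 2)[X]} (h0 : g.coeff 0 = 1) {γ : K} (hγ : γ ≠ 0)
    (hg : aeval γ g = 0) : (shiftRegister g K).IsSolution fun k => γ⁻¹ ^ k := by
  rw [shiftRegister_isSolution_iff]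
  intro k
  rw [aeval_eq_sum_range, Finset.sum_range_eq_add_Ico _ (Nat.succ_pos _), h0] at hg
  have hI : Finset.Ico 1 (g.natDegree + 1) = Finset.Icc 1 g.natDegree := by
    ext; simp
  rw [hI] at hg
  have hsum : ∑ i ∈ Finset.Icc 1 g.natDegree,
      -algebraMap (ZMod 2) K (g.coeff i) * γ⁻¹ ^ (k + g.natDegree - i) =
      -(∑ i ∈ Finset.Icc 1 g.natDegree, g.coeff i • γ ^ i) * γ⁻¹ ^ (k + g.natDegree) := by
    rw [← Finset.sum_neg_distrib, Finset.sum_mul]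
    refine Finset.sum_congr rfl fun i hi => ?_
    have hi' : i ≤ k + g.natDegree := by
      have := (Finset.mem_Icc.1 hi).2
      omega
    rw [Algebra.smul_def, inv_pow, inv_pow, ← pow_sub_mul_pow γ hi']
    field_simp
  have h1 : -(∑ i ∈ Finset.Icc 1 g.natDegree, g.coeff i • γ ^ i) = 1 := by
    rw [neg_eq_iff_add_eq_zero, add_comm]
    simpa using hg
  rw [hsum, h1, one_mul]

/-- If the roots of `g` are simple and nonzero, every sequence generated by `g` is a combination
of the geometric sequences whose ratios are the inverses of the roots. -/
theorem Generates.exists_eq_sum {g : (ZMod 2)[X]} {a : ℕ → ZMod 2} (ha : Generates g a)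
    (h0 : g.coeff 0 = 1) {ι : Type*} [Fintype ι] {ρ : ι → K} (hρ : Function.Injective ρ)
    (hρ0 : ∀ i, ρ i ≠ 0) (hroot : ∀ i, aeval (ρ i) g = 0)
    (hcard : Fintype.card ι = g.natDegree) :
    ∃ c : ι → K, ∀ k, algebraMap (ZMod 2) K (a k) = ∑ i, c i * (ρ i)⁻¹ ^ k := by
  obtain ⟨c, hc⟩ := exists_sum_mul_pow_eq (ρ := fun i => (ρ i)⁻¹) (inv_injective.comp hρ)
    fun k => algebraMap (ZMod 2) K (a k)
  refine ⟨c, fun k => ?_⟩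
  have hsol : (fun k => ∑ i, c i * (ρ i)⁻¹ ^ k) ∈ (shiftRegister g K).solSpace := by
    have : (fun k => ∑ i, c i * (ρ i)⁻¹ ^ k) = ∑ i, c i • fun k => (ρ i)⁻¹ ^ k := by
      funext k
      simp
    rw [this]
    exact Submodule.sum_mem _ fun i _ => Submodule.smul_mem _ _
      (isSolution_inv_pow h0 (hρ0 i) (hroot i))
  have h1 := (shiftRegister g K).eq_mk_of_is_sol_of_eq_init
    (ha.isSolution_algebraMap (K := K)) (fun _ => rfl) k
  have h2 := (shiftRegister g K).eq_mk_of_is_sol_of_eq_init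
    (u := fun k => ∑ i, c i * (ρ i)⁻¹ ^ k) (init := fun k => algebraMap (ZMod 2) K (a k)) hsol
    (fun k => hc k (by rw [hcard]; exact k.2)) k
  exact h1.trans h2.symm

end Sequences

/-! ### Orders of roots and uniform exponents -/

section Exponents

variable {K : Type*} [Field K] [Algebra (ZMod 2) K]

theorem dvd_iff_aeval_eq_zero {p q : (ZMod 2)[X]} (hp : Irreducible p) {α : K}
    (hα : aeval α p = 0) : p ∣ q ↔ aeval α q = 0 := by
  constructor
  · rintro ⟨s, rfl⟩
    rw [map_mul, hα, zero_mul]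
  · intro hq
    by_contra hpq
    obtain ⟨u, w, huw⟩ := hp.coprime_iff_not_dvd.2 hpq
    have := congrArg (aeval α) huw
    simp [hα, hq] at this

theorem hasExponent_iff_orderOf {p : (ZMod 2)[X]} (hp : Irreducible p) {α : K}
    (hα : aeval α p = 0) {e : ℕ} (he : 0 < e) : HasExponent p e ↔ orderOf α = e := by
  have h : ∀ m, p ∣ X ^ m - 1 ↔ α ^ m = 1 := fun m => by
    rw [dvd_iff_aeval_eq_zero hp hα]
    simp [sub_eq_zero]
  simp only [HasExponent, h, orderOf_eq_iff he, IsLeast, lowerBounds, Set.mem_ofPred_eq]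
  constructor
  · rintro ⟨⟨-, h1⟩, h2⟩
    exact ⟨h1, fun m hm h0 hm1 => absurd (h2 ⟨h0, hm1⟩) (not_le.2 hm)⟩
  · rintro ⟨h1, h2⟩
    exact ⟨⟨he, h1⟩, fun m hm => not_lt.1 fun hlt => h2 m hlt hm.1 hm.2⟩

theorem HasUniformExponent.orderOf_eq {f : (ZMod 2)[X]} {e : ℕ} (hf : HasUniformExponent f e)
    {α : K} (hα : aeval α f = 0) : orderOf α = e := by
  obtain ⟨s, hs, rfl⟩ := hf
  rw [map_prod, Finset.prod_eq_zero_iff] at hα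
  obtain ⟨p, hp, hpα⟩ := hα
  exact (hasExponent_iff_orderOf (hs p hp).1 hpα (hs p hp).2.1.1).1 (hs p hp).2

theorem eq_of_associated {p q : (ZMod 2)[X]} (h : Associated p q) : p = q := by
  have hu : ∀ x : ZMod 2, x ≠ 0 → x = 1 := by decide
  obtain ⟨u, rfl⟩ := h
  obtain ⟨c, hc, hcu⟩ := isUnit_iff.1 u.isUnit
  rw [← hcu, hu c hc.ne_zero]
  simp

theorem HasUniformExponent.separable {f : (ZMod 2)[X]} {e : ℕ} (hf : HasUniformExponent f e) :
    f.Separable := by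
  obtain ⟨s, hs, rfl⟩ := hf
  refine separable_prod' (fun p hp q hq hpq => ?_)
    fun p hp => PerfectField.separable_of_irreducible (hs p hp).1
  rw [(hs p hp).1.coprime_iff_not_dvd]
  exact fun hdvd => hpq (eq_of_associated ((hs p hp).1.associated_of_dvd (hs q hq).1 hdvd))

/-- A separable polynomial has uniform exponent `e` if all its roots, in a field over which it
splits, have multiplicative order `e`. -/
theorem hasUniformExponent_of_orderOf {g : (ZMod 2)[X]} {e : ℕ} (he : 0 < e) (hsep : g.Separable)
    (hsplit : (g.map (algebraMap (ZMod 2) K)).Splits)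
    (hord : ∀ α : K, aeval α g = 0 → orderOf α = e) : HasUniformExponent g e := by
  classical
  have hg0 : g ≠ 0 := hsep.ne_zero
  refine ⟨UniqueFactorizationMonoid.primeFactors g, fun p hp => ?_, ?_⟩
  · rw [UniqueFactorizationMonoid.mem_primeFactors] at hp
    have hirr := UniqueFactorizationMonoid.irreducible_of_normalized_factor p hp
    have hdvd := UniqueFactorizationMonoid.dvd_of_mem_normalizedFactors hp
    refine ⟨hirr, ?_⟩
    have hps : (p.map (algebraMap (ZMod 2) K)).Splits :=
      hsplit.of_dvd (map_ne_zero hg0) (Polynomial.map_dvd _ hdvd)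
    obtain ⟨α, hα⟩ := hps.exists_eval_eq_zero (by
      rw [degree_map]
      exact hirr.degree_pos.ne')
    rw [eval_map_algebraMap] at hα
    exact (hasExponent_iff_orderOf hirr hα he).2
      (hord α ((dvd_iff_aeval_eq_zero hirr hα).1 hdvd))
  · exact (eq_of_associated
      (UniqueFactorizationMonoid.radical_associated hsep.squarefree.isRadical hg0)).symm

end Exponents

/-! ### The space of sequences generated by a polynomial -/

section SolutionSpace

variable {K : Type*} [Field K]

theorem Generates.shift {g : (ZMod 2)[X]} {a : ℕ → ZMod 2} (ha : Generates g a) (s : ℕ) :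
    Generates g fun k => a (k + s) := by
  rw [generates_iff] at *
  intro k
  have := ha (k + s)
  rw [show k + s + (shiftRegister g (ZMod 2)).order =
    k + (shiftRegister g (ZMod 2)).order + s by omega] at this
  refine this.trans (Finset.sum_congr rfl fun i _ => ?_)
  dsimp only
  rw [show k + s + i = k + i + s by omega]

/-- The cyclic words of length `r` that, read periodically, are generated by `g`. -/
noncomputable def periodicSolutions (g : (ZMod 2)[X]) (r : ℕ) : Submodule (ZMod 2) (ZMod r → ZMod 2) :=
  (shiftRegister g (ZMod 2)).solSpace.comap (LinearMap.funLeft (ZMod 2) (ZMod 2) Nat.cast)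

theorem mem_periodicSolutions {g : (ZMod 2)[X]} {r : ℕ} {w : ZMod r → ZMod 2} :
    w ∈ periodicSolutions g r ↔ Generates g fun m => w m :=
  (generates_iff g _).symm

variable [Algebra (ZMod 2) K] {g : (ZMod 2)[X]} {r : ℕ} {ι : Type*} [Fintype ι] {ρ : ι → K}

theorem periodic_of_eq_sum {a : ℕ → ZMod 2} {c : ι → K} (hord : ∀ i, orderOf (ρ i) = r)
    (hc : ∀ k, algebraMap (ZMod 2) K (a k) = ∑ i, c i * (ρ i)⁻¹ ^ k) :
    Function.Periodic a r := by
  intro k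
  apply (algebraMap (ZMod 2) K).injective
  have h1 : ∀ i, (ρ i)⁻¹ ^ r = 1 := fun i => by
    rw [inv_pow, ← hord i, pow_orderOf_eq_one, inv_one]
  simp [hc, pow_add, h1]

/-- A period of a nonzero sequence is a period of each geometric sequence that occurs in it. -/
theorem dvd_of_periodic_of_eq_sum {a : ℕ → ZMod 2} {c : ι → K} (hρ : Function.Injective ρ)
    (hord : ∀ i, orderOf (ρ i) = r)
    (hc : ∀ k, algebraMap (ZMod 2) K (a k) = ∑ i, c i * (ρ i)⁻¹ ^ k) (ha0 : a ≠ 0) {p : ℕ}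
    (hp : Function.Periodic a p) : r ∣ p := by
  have hz : (fun i => c i * ((ρ i)⁻¹ ^ p - 1)) = 0 := by
    refine eq_zero_of_sum_mul_pow_eq_zero (ρ := fun i => (ρ i)⁻¹) (inv_injective.comp hρ)
      fun k _ => ?_
    have h1 := hc (k + p)
    rw [hp k, hc k] at h1
    rw [← sub_eq_zero, ← Finset.sum_sub_distrib] at h1
    rw [← neg_eq_zero, ← h1, ← Finset.sum_neg_distrib]
    refine Finset.sum_congr rfl fun i _ => ?_
    rw [pow_add]
    ring
  have hc0 : ∃ i, c i ≠ 0 := by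
    by_contra! h0
    refine ha0 (funext fun k => (algebraMap (ZMod 2) K).injective ?_)
    simp [hc, h0]
  obtain ⟨i, hi⟩ := hc0
  have h1 := (mul_eq_zero.1 (congrFun hz i)).resolve_left hi
  rw [sub_eq_zero, inv_pow, inv_eq_one] at h1
  rw [← hord i]
  exact orderOf_dvd_of_pow_eq_one h1

theorem mem_periodicSolutions_of_periodic {a : ℕ → ZMod 2} (ha : Generates g a)
    (hper : Function.Periodic a r) : (fun x : ZMod r => a x.val) ∈ periodicSolutions g r := by
  rw [mem_periodicSolutions]
  simpa only [ZMod.val_natCast, hper.map_mod_nat] using ha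

variable [NeZero r]

theorem hasLeastPeriod_of_eq_sum {a : ℕ → ZMod 2} {c : ι → K} (hρ : Function.Injective ρ)
    (hord : ∀ i, orderOf (ρ i) = r)
    (hc : ∀ k, algebraMap (ZMod 2) K (a k) = ∑ i, c i * (ρ i)⁻¹ ^ k) (ha0 : a ≠ 0) :
    HasLeastPeriod a r :=
  ⟨⟨Nat.pos_of_ne_zero (NeZero.ne r), periodic_of_eq_sum hord hc⟩,
    fun _ hp => Nat.le_of_dvd hp.1 (dvd_of_periodic_of_eq_sum hρ hord hc ha0 hp.2)⟩

theorem natCast_comp_ne_zero {w : ZMod r → ZMod 2} (hw : w ≠ 0) :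
    (fun m : ℕ => w m) ≠ 0 := by
  refine fun h0 => hw (funext fun x => ?_)
  simpa using congrFun h0 x.val

theorem generatedCycles_eq (hper : ∀ a, Generates g a → Function.Periodic a r) :
    generatedCycles g r = nonzeroClasses (periodicSolutions g r) := by
  ext s
  constructor
  · rintro ⟨a, ha, ha0, rfl⟩
    refine ⟨_, mem_periodicSolutions_of_periodic ha (hper a ha), fun h0 => ha0 ?_, rfl⟩
    funext k
    have := congrFun h0 (k : ZMod r)
    simp only [ZMod.val_natCast, (hper a ha).map_mod_nat] at this
    exact this
  · rintro ⟨w, hw, hw0, rfl⟩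
    refine ⟨_, mem_periodicSolutions.1 hw, natCast_comp_ne_zero hw0, ?_⟩
    simp

theorem isWindowSpace_periodicSolutions
    (hper : ∀ a, Generates g a → a ≠ 0 → ∀ p, Function.Periodic a p ↔ r ∣ p) :
    IsWindowSpace (fun i : Fin g.natDegree => ((i : ℕ) : ZMod r)) (periodicSolutions g r) where
  shift_mem := by
    intro w hw t
    rw [mem_periodicSolutions] at *
    simpa [_root_.shift] using hw.shift t.val
  eq_zero_of_shift_eq := by
    intro w hw hw0 t ht
    rw [← ZMod.natCast_zmod_val t, ZMod.natCast_eq_zero_iff]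
    refine (hper _ (mem_periodicSolutions.1 hw) (natCast_comp_ne_zero hw0) _).1 fun k => ?_
    simpa [_root_.shift] using congrFun ht (k : ZMod r)
  existsUnique_window := by
    intro M
    set a := (shiftRegister g (ZMod 2)).mkSol M with ha
    have hgen : Generates g a := (generates_iff g a).2 ((shiftRegister g (ZMod 2)).is_sol_mkSol M)
    have hp : Function.Periodic a r := by
      by_cases h0 : a = 0
      · rw [h0]
        exact fun _ => rfl
      · exact (hper a hgen h0 r).2 dvd_rfl
    refine ⟨fun x => a x.val, ⟨mem_periodicSolutions_of_periodic hgen hp, fun i => ?_⟩, ?_⟩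
    · simp only [ZMod.val_natCast, hp.map_mod_nat]
      exact (shiftRegister g (ZMod 2)).mkSol_eq_init M i
    · rintro w ⟨hw, hwM⟩
      have := (shiftRegister g (ZMod 2)).eq_mk_of_is_sol_of_eq_init
        ((generates_iff g _).1 (mem_periodicSolutions.1 hw)) hwM
      funext x
      simpa using this x.val

end SolutionSpace

/-! ### The polynomial `f₁ ∨ f₂` -/

section Vee

variable {f₁ f₂ : (ZMod 2)[X]} {r₁ r₂ : ℕ}

theorem mem_rootProducts (h₁ : f₁ ≠ 0) (h₂ : f₂ ≠ 0) {γ : (f₁ * f₂).SplittingField} :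
    γ ∈ rootProducts f₁ f₂ ↔ ∃ α β, aeval α f₁ = 0 ∧ aeval β f₂ = 0 ∧ α * β = γ := by
  classical
  simp [rootProducts, Finset.mem_image₂, h₁, h₂]

theorem aeval_vee_eq_zero_iff {γ : (f₁ * f₂).SplittingField} :
    aeval γ (vee f₁ f₂) = 0 ↔ γ ∈ rootProducts f₁ f₂ := by
  rw [← eval_map_algebraMap, vee_map, eval_prod, Finset.prod_eq_zero_iff]
  simp [sub_eq_zero]

theorem natDegree_vee : (vee f₁ f₂).natDegree = (rootProducts f₁ f₂).card := by
  rw [← natDegree_map (algebraMap (ZMod 2) (f₁ * f₂).SplittingField), vee_map,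
    natDegree_finsetProd_X_sub_C_eq_card]

theorem vee_separable : (vee f₁ f₂).Separable := by
  rw [← separable_map (algebraMap (ZMod 2) (f₁ * f₂).SplittingField), vee_map,
    separable_prod_X_sub_C_iff']
  exact fun _ _ _ _ h => h

theorem vee_splits :
    ((vee f₁ f₂).map (algebraMap (ZMod 2) (f₁ * f₂).SplittingField)).Splits := by
  rw [vee_map]
  exact Splits.prod fun γ _ => Splits.X_sub_C γ

theorem ne_zero_of_orderOf {K : Type*} [Field K] {α : K} {r : ℕ} (hr : 0 < r)
    (hα : orderOf α = r) : α ≠ 0 := by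
  rintro rfl
  rw [orderOf_zero] at hα
  omega

/-- The order of `α / α' = β' / β` divides both `r₁` and `r₂`. -/
theorem eq_and_eq_of_mul_eq_mul {K : Type*} [Field K] (hr₁ : 0 < r₁) (hr₂ : 0 < r₂)
    (hcop : Nat.Coprime r₁ r₂) {α α' β β' : K} (hα : orderOf α = r₁) (hα' : orderOf α' = r₁)
    (hβ : orderOf β = r₂) (hβ' : orderOf β' = r₂) (h : α * β = α' * β') : α = α' ∧ β = β' := by
  have hα0 := ne_zero_of_orderOf hr₁ hα'
  have hβ0 := ne_zero_of_orderOf hr₂ hβ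
  have hu : α / α' = β' / β := by
    rw [div_eq_div_iff hα0 hβ0, h, mul_comm]
  have hpow : ∀ {x : K} {r}, orderOf x = r → x ^ r = 1 := by
    rintro x _ rfl
    exact pow_orderOf_eq_one x
  have h1 : orderOf (α / α') ∣ r₁ := orderOf_dvd_of_pow_eq_one (by
    rw [div_pow, hpow hα, hpow hα', div_one])
  have h2 : orderOf (α / α') ∣ r₂ := orderOf_dvd_of_pow_eq_one (by
    rw [hu, div_pow, hpow hβ, hpow hβ', div_one])
  have h3 : α / α' = 1 := orderOf_eq_one_iff.1 (Nat.eq_one_of_dvd_coprimes hcop h1 h2)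
  have h4 : α = α' := (div_eq_one_iff_eq hα0).1 h3
  exact ⟨h4, mul_left_cancel₀ hα0 (h4 ▸ h)⟩

theorem rootSet_mul_injective {K : Type*} [Field K] [Algebra (ZMod 2) K] (hr₁ : 0 < r₁)
    (hr₂ : 0 < r₂) (hcop : Nat.Coprime r₁ r₂) (hexp₁ : HasUniformExponent f₁ r₁)
    (hexp₂ : HasUniformExponent f₂ r₂) :
    Function.Injective fun p : f₁.rootSet K × f₂.rootSet K => (p.1 : K) * p.2 := fun p q h => by
  have := eq_and_eq_of_mul_eq_mul hr₁ hr₂ hcop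
    (hexp₁.orderOf_eq (aeval_eq_zero_of_mem_rootSet p.1.2))
    (hexp₁.orderOf_eq (aeval_eq_zero_of_mem_rootSet q.1.2))
    (hexp₂.orderOf_eq (aeval_eq_zero_of_mem_rootSet p.2.2))
    (hexp₂.orderOf_eq (aeval_eq_zero_of_mem_rootSet q.2.2)) h
  exact Prod.ext (Subtype.ext this.1) (Subtype.ext this.2)

theorem HasUniformExponent.ne_zero {f : (ZMod 2)[X]} {e : ℕ} (hf : HasUniformExponent f e) :
    f ≠ 0 := hf.separable.ne_zero

theorem orderOf_of_aeval_vee (hcop : Nat.Coprime r₁ r₂) (hexp₁ : HasUniformExponent f₁ r₁)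
    (hexp₂ : HasUniformExponent f₂ r₂) {γ : (f₁ * f₂).SplittingField}
    (hγ : aeval γ (vee f₁ f₂) = 0) : orderOf γ = r₁ * r₂ := by
  rw [aeval_vee_eq_zero_iff, mem_rootProducts hexp₁.ne_zero hexp₂.ne_zero] at hγ
  obtain ⟨α, β, hα, hβ, rfl⟩ := hγ
  have h1 := hexp₁.orderOf_eq hα
  have h2 := hexp₂.orderOf_eq hβ
  rw [(Commute.all α β).orderOf_mul_eq_mul_orderOf_of_coprime (by rwa [h1, h2]), h1, h2]

theorem card_rootSet_of_dvd {f h : (ZMod 2)[X]} {e : ℕ} (hf : HasUniformExponent f e)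
    (hh : h ≠ 0) (hfh : f ∣ h) : Fintype.card (f.rootSet h.SplittingField) = f.natDegree :=
  card_rootSet_eq_natDegree hf.separable
    ((SplittingField.splits h).of_dvd (map_ne_zero hh) (Polynomial.map_dvd _ hfh))

theorem natDegree_vee_eq_mul (hr₁ : 0 < r₁) (hr₂ : 0 < r₂) (hcop : Nat.Coprime r₁ r₂)
    (hexp₁ : HasUniformExponent f₁ r₁) (hexp₂ : HasUniformExponent f₂ r₂) :
    (vee f₁ f₂).natDegree = f₁.natDegree * f₂.natDegree := by
  classical
  have hne := mul_ne_zero hexp₁.ne_zero hexp₂.ne_zero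
  rw [natDegree_vee, ← card_rootSet_of_dvd hexp₁ hne (dvd_mul_right _ _),
    ← card_rootSet_of_dvd hexp₂ hne (dvd_mul_left _ _), ← Fintype.card_prod,
    ← Finset.card_univ]
  symm
  refine Finset.card_bij (fun p _ => p.1.1 * p.2.1) ?_ ?_ ?_
  · rintro ⟨α, β⟩ -
    exact (mem_rootProducts hexp₁.ne_zero hexp₂.ne_zero).2
      ⟨α, β, aeval_eq_zero_of_mem_rootSet α.2, aeval_eq_zero_of_mem_rootSet β.2, rfl⟩
  · exact fun p _ q _ h => rootSet_mul_injective hr₁ hr₂ hcop hexp₁ hexp₂ h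
  · intro γ hγ
    obtain ⟨α, β, hα, hβ, rfl⟩ := (mem_rootProducts hexp₁.ne_zero hexp₂.ne_zero).1 hγ
    exact ⟨(⟨α, mem_rootSet.2 ⟨hexp₁.ne_zero, hα⟩⟩, ⟨β, mem_rootSet.2 ⟨hexp₂.ne_zero, hβ⟩⟩),
      Finset.mem_univ _, rfl⟩

theorem coeff_zero_vee (hr₁ : 0 < r₁) (hr₂ : 0 < r₂) (hcop : Nat.Coprime r₁ r₂)
    (hexp₁ : HasUniformExponent f₁ r₁) (hexp₂ : HasUniformExponent f₂ r₂) :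
    (vee f₁ f₂).coeff 0 = 1 := by
  have hu : ∀ x : ZMod 2, x ≠ 0 → x = 1 := by decide
  refine hu _ fun h0 => ?_
  have hroot : aeval (0 : (f₁ * f₂).SplittingField) (vee f₁ f₂) = 0 := by
    rw [aeval_def, eval₂_at_zero, h0, map_zero]
  exact ne_zero_of_orderOf (Nat.mul_pos hr₁ hr₂)
    (orderOf_of_aeval_vee hcop hexp₁ hexp₂ hroot) rfl

/-- The power-sum representation of a sequence generated by `f₁ ∨ f₂`, with the ratios indexed by
the pairs of a root of `f₁` and a root of `f₂`. -/
theorem Generates.exists_eq_sum_vee (hr₁ : 0 < r₁) (hr₂ : 0 < r₂) (hcop : Nat.Coprime r₁ r₂)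
    (hexp₁ : HasUniformExponent f₁ r₁) (hexp₂ : HasUniformExponent f₂ r₂) {a : ℕ → ZMod 2}
    (ha : Generates (vee f₁ f₂) a) :
    ∃ (ρ : f₁.rootSet (f₁ * f₂).SplittingField × f₂.rootSet (f₁ * f₂).SplittingField →
        (f₁ * f₂).SplittingField) (c : _ → (f₁ * f₂).SplittingField),
      (∀ p, ρ p = p.1 * p.2) ∧ Function.Injective ρ ∧ (∀ p, orderOf (ρ p) = r₁ * r₂) ∧
      ∀ k, algebraMap (ZMod 2) _ (a k) = ∑ p, c p * (ρ p)⁻¹ ^ k := by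
  have hne := mul_ne_zero hexp₁.ne_zero hexp₂.ne_zero
  let ρ : f₁.rootSet (f₁ * f₂).SplittingField × f₂.rootSet (f₁ * f₂).SplittingField →
    (f₁ * f₂).SplittingField := fun p => p.1 * p.2
  have hroot : ∀ p, aeval (ρ p) (vee f₁ f₂) = 0 := fun p =>
    aeval_vee_eq_zero_iff.2 <| (mem_rootProducts hexp₁.ne_zero hexp₂.ne_zero).2
      ⟨p.1, p.2, aeval_eq_zero_of_mem_rootSet p.1.2, aeval_eq_zero_of_mem_rootSet p.2.2, rfl⟩
  have hord : ∀ p, orderOf (ρ p) = r₁ * r₂ := fun p =>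
    orderOf_of_aeval_vee hcop hexp₁ hexp₂ (hroot p)
  have hinj : Function.Injective ρ := rootSet_mul_injective hr₁ hr₂ hcop hexp₁ hexp₂
  obtain ⟨c, hc⟩ := ha.exists_eq_sum (coeff_zero_vee hr₁ hr₂ hcop hexp₁ hexp₂) hinj
    (fun p => ne_zero_of_orderOf (Nat.mul_pos hr₁ hr₂) (hord p)) hroot
    (by rw [Fintype.card_prod, card_rootSet_of_dvd hexp₁ hne (dvd_mul_right _ _),
      card_rootSet_of_dvd hexp₂ hne (dvd_mul_left _ _),
      natDegree_vee_eq_mul hr₁ hr₂ hcop hexp₁ hexp₂])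
  exact ⟨ρ, c, fun _ => rfl, hinj, hord, hc⟩

/-- A sequence generated by `f₁ ∨ f₂` vanishes if the `n₁ × n₂` window at the origin of its folding
does. -/
theorem Generates.eq_zero_of_window_vee (hr₁ : 0 < r₁) (hr₂ : 0 < r₂) (hcop : Nat.Coprime r₁ r₂)
    (hexp₁ : HasUniformExponent f₁ r₁) (hexp₂ : HasUniformExponent f₂ r₂) {a : ℕ → ZMod 2}
    (ha : Generates (vee f₁ f₂) a)
    (hw : ∀ i < f₁.natDegree, ∀ j < f₂.natDegree, ∃ k, k ≡ i [MOD r₁] ∧ k ≡ j [MOD r₂] ∧ a k = 0) :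
    a = 0 := by
  obtain ⟨ρ, c, hρ, -, -, hc⟩ := ha.exists_eq_sum_vee hr₁ hr₂ hcop hexp₁ hexp₂
  have hne := mul_ne_zero hexp₁.ne_zero hexp₂.ne_zero
  have hc0 : c = 0 := by
    refine eq_zero_of_sum_mul_pow_mul_pow_eq_zero
      (ρ := fun α : f₁.rootSet (f₁ * f₂).SplittingField => (α : (f₁ * f₂).SplittingField)⁻¹)
      (σ := fun β : f₂.rootSet (f₁ * f₂).SplittingField => (β : (f₁ * f₂).SplittingField)⁻¹)
      (inv_injective.comp Subtype.val_injective) (inv_injective.comp Subtype.val_injective)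
      fun i hi j hj => ?_
    rw [card_rootSet_of_dvd hexp₁ hne (dvd_mul_right _ _)] at hi
    rw [card_rootSet_of_dvd hexp₂ hne (dvd_mul_left _ _)] at hj
    obtain ⟨k, hki, hkj, hak⟩ := hw i hi j hj
    rw [← map_zero (algebraMap (ZMod 2) _), ← hak, hc]
    refine Finset.sum_congr rfl fun p _ => ?_
    -- modulo `r₁` the exponent of `α` may be replaced by `i`, modulo `r₂` that of `β` by `j`
    have h1 : (p.1 : (f₁ * f₂).SplittingField) ^ k = p.1 ^ i := by
      have := hexp₁.orderOf_eq (aeval_eq_zero_of_mem_rootSet p.1.2)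
      rw [← this] at hki
      exact pow_eq_pow_of_modEq hki (pow_orderOf_eq_one _)
    have h2 : (p.2 : (f₁ * f₂).SplittingField) ^ k = p.2 ^ j := by
      have := hexp₂.orderOf_eq (aeval_eq_zero_of_mem_rootSet p.2.2)
      rw [← this] at hkj
      exact pow_eq_pow_of_modEq hkj (pow_orderOf_eq_one _)
    rw [hρ, mul_inv, mul_pow, inv_pow, inv_pow, inv_pow, inv_pow, h1, h2]
  funext k
  apply (algebraMap (ZMod 2) (f₁ * f₂).SplittingField).injective
  simp [hc, hc0]

end Vee

/-! ### Folding and the array code -/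

/-- The arrays obtained by folding the words of a space of words. -/
def foldedSpace {r₁ r₂ : ℕ} (h : Nat.Coprime r₁ r₂)
    (V : Submodule (ZMod 2) (ZMod (r₁ * r₂) → ZMod 2)) :
    Submodule (ZMod 2) (ZMod r₁ × ZMod r₂ → ZMod 2) :=
  V.map (LinearMap.funLeft (ZMod 2) (ZMod 2) (ZMod.chineseRemainder h).toAddEquiv.symm)

theorem foldedCode_eq {r₁ r₂ : ℕ} (h : Nat.Coprime r₁ r₂) {g : (ZMod 2)[X]}
    {V : Submodule (ZMod 2) (ZMod (r₁ * r₂) → ZMod 2)}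
    (hg : generatedCycles g (r₁ * r₂) = nonzeroClasses V) :
    foldedCode h g = nonzeroClasses (foldedSpace h V) := by
  rw [foldedCode, hg]
  ext s
  constructor
  · rintro ⟨_, ⟨A, hA, hA0, rfl⟩, rfl⟩
    refine ⟨_, ⟨A, hA, rfl⟩, fun h0 => hA0 ?_, rfl⟩
    funext x
    simpa [LinearMap.funLeft] using congrFun h0 (ZMod.chineseRemainder h x)
  · rintro ⟨_, ⟨A, hA, rfl⟩, hA0, rfl⟩
    refine ⟨_, ⟨A, hA, ?_, rfl⟩, rfl⟩
    rintro rfl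
    exact hA0 (map_zero _)

theorem mainTheorem1 (r₁ r₂ n₁ n₂ : ℕ) (hr₁ : 0 < r₁) (hr₂ : 0 < r₂) (hn₁ : 0 < n₁)
    (hn₂ : 0 < n₂) (hcop : Nat.Coprime r₁ r₂) (f₁ f₂ : Polynomial (ZMod 2))
    (hdeg₁ : f₁.natDegree = n₁) (hdeg₂ : f₂.natDegree = n₂)
    (hexp₁ : HasUniformExponent f₁ r₁) (hexp₂ : HasUniformExponent f₂ r₂) :
    ((vee f₁ f₂).natDegree = n₁ * n₂ ∧ HasUniformExponent (vee f₁ f₂) (r₁ * r₂)) ∧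
    ProducesZeroFactor (vee f₁ f₂) (n₁ * n₂) (r₁ * r₂) ∧
    IsPRAC r₁ r₂ n₁ n₂ (foldedCode hcop (vee f₁ f₂)) ∧
    (foldedCode hcop (vee f₁ f₂)).ncard = (2 ^ (n₁ * n₂) - 1) / (r₁ * r₂) := by
  have hr : 0 < r₁ * r₂ := Nat.mul_pos hr₁ hr₂
  have : NeZero (r₁ * r₂) := ⟨hr.ne'⟩
  have hdeg : (vee f₁ f₂).natDegree = n₁ * n₂ := by
    rw [natDegree_vee_eq_mul hr₁ hr₂ hcop hexp₁ hexp₂, hdeg₁, hdeg₂]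
  have hleast : ∀ a, Generates (vee f₁ f₂) a → a ≠ 0 → HasLeastPeriod a (r₁ * r₂) := by
    intro a ha ha0
    obtain ⟨ρ, c, -, hinj, hord, hc⟩ := ha.exists_eq_sum_vee hr₁ hr₂ hcop hexp₁ hexp₂
    exact hasLeastPeriod_of_eq_sum hinj hord hc ha0
  have hper : ∀ a, Generates (vee f₁ f₂) a → Function.Periodic a (r₁ * r₂) := by
    intro a ha
    obtain ⟨ρ, c, -, -, hord, hc⟩ := ha.exists_eq_sum_vee hr₁ hr₂ hcop hexp₁ hexp₂
    exact periodic_of_eq_sum hord hc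
  have hdvd : ∀ a, Generates (vee f₁ f₂) a → a ≠ 0 →
      ∀ p, Function.Periodic a p ↔ r₁ * r₂ ∣ p := by
    intro a ha ha0 p
    refine ⟨fun hp => ?_, ?_⟩
    · obtain ⟨ρ, c, -, hinj, hord, hc⟩ := ha.exists_eq_sum_vee hr₁ hr₂ hcop hexp₁ hexp₂
      exact dvd_of_periodic_of_eq_sum hinj hord hc ha0 hp
    · rintro ⟨q, rfl⟩
      rw [mul_comm]
      exact (hper a ha).nat_mul q
  have hcyc := generatedCycles_eq hper
  have hseq := isWindowSpace_periodicSolutions hdvd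
  have harr : IsWindowSpace (arrayWindow r₁ r₂ n₁ n₂)
      (foldedSpace hcop (periodicSolutions (vee f₁ f₂) (r₁ * r₂))) := by
    have hzero : ∀ w ∈ periodicSolutions (vee f₁ f₂) (r₁ * r₂),
        (∀ p, w ((ZMod.chineseRemainder hcop).symm (arrayWindow r₁ r₂ n₁ n₂ p)) = 0) → w = 0 := by
      intro w hw hz
      by_contra hw0
      refine natCast_comp_ne_zero hw0 ((mem_periodicSolutions.1 hw).eq_zero_of_window_vee
        hr₁ hr₂ hcop hexp₁ hexp₂ fun i hi j hj => ?_)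
      set x := (ZMod.chineseRemainder hcop).symm ((i : ZMod r₁), (j : ZMod r₂)) with hx
      -- `x.val` is the position in the sequence of the entry that folding puts into the cell `(i, j)`
      have hx' : ((x.val : ZMod r₁), (x.val : ZMod r₂)) = ((i : ZMod r₁), (j : ZMod r₂)) := by
        have h1 := map_natCast (ZMod.chineseRemainder hcop) x.val
        rw [ZMod.natCast_zmod_val, hx, RingEquiv.apply_symm_apply, ← hx] at h1
        exact h1.symm
      rw [Prod.mk.injEq, ZMod.natCast_eq_natCast_iff, ZMod.natCast_eq_natCast_iff] at hx'
      refine ⟨x.val, hx'.1, hx'.2, ?_⟩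
      rw [ZMod.natCast_zmod_val]
      exact hz (⟨i, hdeg₁ ▸ hi⟩, ⟨j, hdeg₂ ▸ hj⟩)
    have h := (hseq.of_card_eq _ (by simp [hdeg]) hzero).map_equiv
      (ZMod.chineseRemainder hcop).toAddEquiv
    simpa [foldedSpace] using h
  have hcard := harr.ncard_mul_card
  rw [← foldedCode_eq hcop hcyc, Nat.card_prod, Nat.card_prod, Nat.card_zmod, Nat.card_zmod,
    Nat.card_fin, Nat.card_fin] at hcard
  refine ⟨⟨hdeg, hasUniformExponent_of_orderOf hr vee_separable vee_splits
    fun γ hγ => orderOf_of_aeval_vee hcop hexp₁ hexp₂ hγ⟩, ⟨hleast, ⟨?_, ?_⟩⟩,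
    ⟨⟨⟨_, (mul_comm _ _).trans hcard |>.symm⟩, ?_, ?_⟩, ?_⟩, ?_⟩
  · intro w hw
    rw [hcyc, hseq.toCyclic_mem_iff] at hw
    exact hleast _ (mem_periodicSolutions.1 hw.1) (natCast_comp_ne_zero hw.2)
  · rw [hcyc, ← hdeg]
    exact hseq.nonzeroWindowsOnce
  · rw [foldedCode_eq hcop hcyc]
    exact harr.nonzeroWindowsOnce
  · rw [foldedCode_eq hcop hcyc]
    exact fun c hc => harr.occurrences_zero hc
  · rw [foldedCode_eq hcop hcyc]
    intro A B hA hB hAB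
    refine harr.toCyclic_add_mem hA hB ?_
    rintro rfl
    obtain hne | ⟨t, ht, htA⟩ := hAB
    · exact hne rfl
    · rw [harr.toCyclic_mem_iff] at hA
      exact ht (harr.eq_zero_of_shift_eq A hA.1 hA.2 t htA.symm)
  · rw [← hcard, Nat.mul_div_cancel _ hr]
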